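/- Let $\mu_1,\mu_*>0$ and $F_1,F_*,\tau\in\mathbb{R}$, and put $\zeta=\mu_1/\mu_*$. For $\psi_1,\psi_2>0$ let $\nu_1,\nu_2:\mathbb{C}_+\to\mathbb{C}_+$ (with $\mathbb{C}_+$ the open upper half plane) be the functions determined by the following conditions: they are analytic on $\mathbb{C}_+$; for every $\xi\in\mathbb{C}_+$ they satisfy $$\nu_1=\psi_1\Bigl(-\xi-\nu_2-\frac{\zeta^2\nu_2}{1-\zeta^2\nu_1\nu_2}\Bigr)^{-1},\qquad \nu_2=\psi_2\Bigl(-\xi-\nu_1-\frac{\zeta^2\nu_1}{1-\zeta^2\nu_1\nu_2}\Bigr)^{-1};$$ and there is a constant $C>0$ such that, whenever $\operatorname{Im}\xi>C$, the pair $(\nu_1(\xi),\nu_2(\xi))$ is the unique solution of these equations in $\mathbb{C}^2$ with $|\nu_1|\le\psi_1/\operatorname{Im}\xi$ and $|\nu_2|\le\psi_2/\operatorname{Im}\xi$. For $\lambda>0$ define $$\chi=\nu_1\Bigl(\tfrac{i\sqrt{\psi_1\psi_2\lambda}}{\mu_*}\Bigr)\,\nu_2\Bigl(\tfrac{i\sqrt{\psi_1\psi_2\lambda}}{\mu_*}\Bigr),\qquad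 \mathcal{S}^2(\psi_1,\psi_2,\lambda)=\frac{F_1^2}{1-\chi\zeta^2}+F_*^2+\tau^2 .$$ ($\mathcal{S}^2$ is the asymptotic expected posterior predictive variance of the random features model with ridge parameter $\lambda$.) Then $\mathcal{S}^2$ is well defined: such a pair $(\nu_1,\nu_2)$ exists and is unique on $\mathbb{C}_+$, $1-\chi\zeta^2\neq0$, and $\mathcal{S}^2$ is a real number. Moreover: 1. For all $\psi_1,\psi_2>0$, the map $\lambda\mapsto\mathcal{S}^2(\psi_1,\psi_2,\lambda)$ is non-decreasing on $(0,\infty)$. 2. If $\psi_1=\psi_2>0$, the limit $\lim_{\lambda\to0^+}\mathcal{S}^2(\psi_1,\psi_2,\lambda)$ exists and is finite. -/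

import Mathlib

open Set Filter Topology

/-- The open upper half plane, as a subset of `ℂ`. -/
def upperHalf : Set ℂ := {ξ : ℂ | 0 < ξ.im}

/-- The pair `(z₁, z₂)` satisfies the two coupled fixed point equations at the point `ξ`. -/
def FixedPointEqs (ψ₁ ψ₂ ζ : ℝ) (ξ z₁ z₂ : ℂ) : Prop :=
  z₁ = (ψ₁ : ℂ) * (-ξ - z₂ - (ζ : ℂ) ^ 2 * z₂ / (1 - (ζ : ℂ) ^ 2 * z₁ * z₂))⁻¹ ∧
  z₂ = (ψ₂ : ℂ) * (-ξ - z₁ - (ζ : ℂ) ^ 2 * z₁ / (1 - (ζ : ℂ) ^ 2 * z₁ * z₂))⁻¹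

/-- The conditions that characterize the pair of functions `ν = (ν₁, ν₂)` on the upper half plane.
The values outside the upper half plane are irrelevant. -/
structure IsNuPair (ψ₁ ψ₂ ζ : ℝ) (ν : (ℂ → ℂ) × (ℂ → ℂ)) : Prop where
  mapsTo_fst : MapsTo ν.1 upperHalf upperHalf
  mapsTo_snd : MapsTo ν.2 upperHalf upperHalf
  analytic_fst : AnalyticOnNhd ℂ ν.1 upperHalf
  analytic_snd : AnalyticOnNhd ℂ ν.2 upperHalf
  eqs : ∀ ξ ∈ upperHalf, FixedPointEqs ψ₁ ψ₂ ζ ξ (ν.1 ξ) (ν.2 ξ)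
  /-- For large imaginary part, `(ν₁ ξ, ν₂ ξ)` is the unique solution of the equations within the
  bounds `|z₁| ≤ ψ₁ / Im ξ`, `|z₂| ≤ ψ₂ / Im ξ`. -/
  unique_large : ∃ C : ℝ, 0 < C ∧ ∀ ξ : ℂ, C < ξ.im →
    (‖ν.1 ξ‖ ≤ ψ₁ / ξ.im ∧ ‖ν.2 ξ‖ ≤ ψ₂ / ξ.im) ∧
    ∀ z₁ z₂ : ℂ, FixedPointEqs ψ₁ ψ₂ ζ ξ z₁ z₂ → ‖z₁‖ ≤ ψ₁ / ξ.im → ‖z₂‖ ≤ ψ₂ / ξ.im →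
      z₁ = ν.1 ξ ∧ z₂ = ν.2 ξ

/-- The pair `(ν₁, ν₂)`; on the upper half plane it is determined by `IsNuPair`. -/
noncomputable def nuPair (ψ₁ ψ₂ ζ : ℝ) : (ℂ → ℂ) × (ℂ → ℂ) :=
  Classical.epsilon (IsNuPair ψ₁ ψ₂ ζ)

/-- `χ = ν₁(i √(ψ₁ψ₂λ) / μ⋆) ν₂(i √(ψ₁ψ₂λ) / μ⋆)`, with `ζ = μ₁ / μ⋆`. -/
noncomputable def chi (μ₁ μs ψ₁ ψ₂ lam : ℝ) : ℂ :=
  (nuPair ψ₁ ψ₂ (μ₁ / μs)).1 (Complex.I * ((Real.sqrt (ψ₁ * ψ₂ * lam) / μs : ℝ) : ℂ)) *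
  (nuPair ψ₁ ψ₂ (μ₁ / μs)).2 (Complex.I * ((Real.sqrt (ψ₁ * ψ₂ * lam) / μs : ℝ) : ℂ))

/-- The formula `F₁² / (1 - χ ζ²) + F⋆² + τ²`, as a complex number. -/
noncomputable def limitPPVComplex (μ₁ μs F₁ Fs τ ψ₁ ψ₂ lam : ℝ) : ℂ :=
  (F₁ : ℂ) ^ 2 / (1 - chi μ₁ μs ψ₁ ψ₂ lam * ((μ₁ / μs : ℝ) : ℂ) ^ 2) + (Fs : ℂ) ^ 2 + (τ : ℂ) ^ 2

/-- The limiting expected posterior predictive variance `𝒮²(ψ₁, ψ₂, λ)`, a real number. -/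
noncomputable def limitPPV (μ₁ μs F₁ Fs τ ψ₁ ψ₂ lam : ℝ) : ℝ :=
  (limitPPVComplex μ₁ μs F₁ Fs τ ψ₁ ψ₂ lam).re

/-! On the imaginary axis, at `ξ = i s`, both functions are purely imaginary, so `χ = -q` with `q >
0` and the variance is `F₁² / (1 + q ζ²)` plus constants. With `G(q) = q + ζ² q / (1 + ζ² q)`, the
two equations combine into `s² q = (ψ₁ - G(q)) (ψ₂ - G(q))` with both factors positive
(`exists_negProdEq`). Since `G` increases, `q` cannot increase with `s` (`NegProdEq.le_of_le`). As
`s` is a multiple of `√λ`, monotonicity in `λ` follows, and nonnegativity then gives the limit at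
`0⁺`.

Existence comes from iterating the fixed point map from `0`. The iterates stay in the closed upper
half plane with norms at most `ψ / Im ξ`; they converge where `Im ξ` is large, because the map
contracts there, and Vitali's theorem carries the convergence to the whole half plane. The identity
theorem gives uniqueness. -/

/-! ### Vitali's theorem on discs and on the upper half plane. -/

/-- **Vitali's theorem on a disc**: a uniformly bounded sequence of holomorphic functions on a disc
which is uniformly Cauchy on a smaller concentric disc converges pointwise on the whole disc, to a
holomorphic function. -/
theorem exists_differentiableOn_tendsto_of_uniformCauchySeqOn_ball {E : Type*}
    [NormedAddCommGroup E] [NormedSpace ℂ E] [CompleteSpace E] {f : ℕ → ℂ → E} {a : ℂ} {r R M : ℝ}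
    (hr : 0 < r) (hrR : r ≤ R) (hf : ∀ n, DifferentiableOn ℂ (f n) (Metric.ball a R))
    (hM : ∀ n, ∀ z ∈ Metric.ball a R, ‖f n z‖ ≤ M)
    (hC : UniformCauchySeqOn f atTop (Metric.ball a r)) :
    ∃ g : ℂ → E, DifferentiableOn ℂ g (Metric.ball a R) ∧
      ∀ z ∈ Metric.ball a R, Tendsto (fun n => f n z) atTop (𝓝 (g z)) := by
  have hR : 0 < R := hr.trans_le hrR
  have hdc : ∀ n, ∀ ρ < R, DiffContOnCl ℂ (f n) (Metric.ball a ρ) := fun n ρ hρ =>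
    ((hf n).mono (Metric.closedBall_subset_ball hρ)).diffContOnCl_ball subset_rfl
  -- Cauchy's estimate on the circle of radius `r / 2` makes each Taylor coefficient at `a` a Cauchy
  -- sequence.
  have hcauchy : ∀ k, CauchySeq (fun n => iteratedDeriv k (f n) a) := by
    intro k
    rw [Metric.cauchySeq_iff]
    intro ε hε
    have hr2 : 0 < r / 2 := by positivity
    obtain ⟨N, hN⟩ := Metric.uniformCauchySeqOn_iff.1 hC (ε / 2 * (r / 2) ^ k / k.factorial)
      (by positivity)
    refine ⟨N, fun m hm n hn => ?_⟩
    have hcd : ∀ n, ContDiffAt ℂ k (f n) a := fun n =>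
      ((hf n).analyticAt (Metric.ball_mem_nhds a hR)).contDiffAt
    rw [dist_eq_norm, ← iteratedDeriv_sub (hcd m) (hcd n)]
    refine (Complex.norm_iteratedDeriv_le_of_forall_mem_sphere_norm_le k hr2
      ((hdc m _ (by linarith)).sub (hdc n _ (by linarith)))
      (C := ε / 2 * (r / 2) ^ k / k.factorial) fun z hz => ?_).trans_lt ?_
    · have := hN m hm n hn z (Metric.closedBall_subset_ball (by linarith)
        (Metric.sphere_subset_closedBall hz))
      rw [dist_eq_norm] at this
      exact this.le
    · have : (k.factorial : ℝ) * (ε / 2 * (r / 2) ^ k / k.factorial) / (r / 2) ^ k = ε / 2 := by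
        field_simp
      rw [this]
      linarith
  choose d hd using fun k => cauchySeq_tendsto_of_complete (hcauchy k)
  have hM0 : 0 ≤ M := (norm_nonneg _).trans (hM 0 a (Metric.mem_ball_self hR))
  have hbound : ∀ n k, ∀ ρ, 0 < ρ → ρ < R → ‖iteratedDeriv k (f n) a‖ ≤ k.factorial * M / ρ ^ k :=
    fun n k ρ hρ hρR => Complex.norm_iteratedDeriv_le_of_forall_mem_sphere_norm_le k hρ
      (hdc n ρ hρR) fun z hz => hM n z
        (Metric.closedBall_subset_ball hρR (Metric.sphere_subset_closedBall hz))
  -- A geometric majorant for the Taylor terms, with `v` arbitrary so that it serves both the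
  -- functions `f n` and the limit coefficients `d k`.
  have hterm : ∀ (k : ℕ) (ρ s : ℝ) (v : E) (z : ℂ), 0 < ρ → ‖v‖ ≤ k.factorial * M / ρ ^ k →
      ‖z - a‖ ≤ s → ‖(k.factorial : ℂ)⁻¹ • (z - a) ^ k • v‖ ≤ M * (s / ρ) ^ k := by
    intro k ρ s v z hρ hv hs
    rw [norm_smul, norm_smul, norm_inv, norm_pow, Complex.norm_natCast]
    calc ((k.factorial : ℝ))⁻¹ * (‖z - a‖ ^ k * ‖v‖)
        ≤ ((k.factorial : ℝ))⁻¹ * (s ^ k * (k.factorial * M / ρ ^ k)) := by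
          have := (norm_nonneg (z - a)).trans hs
          gcongr
      _ = M * (s / ρ) ^ k := by
          rw [div_pow]
          field_simp
  have hsummable : ∀ s ρ : ℝ, 0 ≤ s → s < ρ → Summable fun k : ℕ => M * (s / ρ) ^ k :=
    fun s ρ hs hsρ => (summable_geometric_of_lt_one (div_nonneg hs (hs.trans hsρ.le))
      ((div_lt_one (hs.trans_lt hsρ)).2 hsρ)).mul_left M
  refine ⟨fun z => ∑' k : ℕ, (k.factorial : ℂ)⁻¹ • (z - a) ^ k • d k, ?_, ?_⟩
  · intro z hz
    obtain ⟨s, hzs, hsR⟩ := exists_between (mem_ball_iff_norm.1 hz)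
    obtain ⟨ρ, hsρ, hρR⟩ := exists_between hsR
    have hs : 0 < s := (norm_nonneg _).trans_lt hzs
    refine ((Complex.differentiableOn_tsum_of_summable_norm (hsummable s ρ hs.le hsρ) (fun k => ?_)
      Metric.isOpen_ball fun k w hw => hterm k ρ s (d k) w (hs.trans hsρ) ?_
        (mem_ball_iff_norm.1 hw).le).differentiableAt (Metric.isOpen_ball.mem_nhds
          (mem_ball_iff_norm.2 hzs : z ∈ Metric.ball a s))).differentiableWithinAt
    · fun_prop
    · exact le_of_tendsto (hd k).norm
        (Eventually.of_forall fun n => hbound n k ρ (hs.trans hsρ) hρR)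
  · intro z hz
    obtain ⟨ρ, hzρ, hρR⟩ := exists_between (mem_ball_iff_norm.1 hz)
    have hρ : 0 < ρ := (norm_nonneg _).trans_lt hzρ
    have := tendsto_tsum_of_dominated_convergence (𝓕 := atTop)
      (f := fun n (k : ℕ) => (k.factorial : ℂ)⁻¹ • (z - a) ^ k • iteratedDeriv k (f n) a)
      (hsummable _ ρ (norm_nonneg (z - a)) hzρ)
      (fun k => ((hd k).const_smul ((z - a) ^ k)).const_smul (k.factorial : ℂ)⁻¹)
      (Eventually.of_forall fun n k => hterm k ρ _ _ z hρ (hbound n k ρ hρ hρR) le_rfl)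
    exact this.congr fun n => Complex.taylorSeries_eq_on_ball (hf n) hz

/-- A sequence of holomorphic functions on the upper half plane that is bounded on each half plane
`{Im ξ > δ}` and uniformly Cauchy on some `{Im ξ > C}` converges pointwise, to a holomorphic
function. -/
theorem exists_differentiableOn_tendsto_upperHalf {E : Type*}
    [NormedAddCommGroup E] [NormedSpace ℂ E] [CompleteSpace E] {f : ℕ → ℂ → E} {A C : ℝ}
    (hC : 0 < C) (hA : 0 ≤ A) (hf : ∀ n, DifferentiableOn ℂ (f n) upperHalf)
    (hbd : ∀ n, ∀ z ∈ upperHalf, ‖f n z‖ ≤ A / z.im)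
    (hcauchy : UniformCauchySeqOn f atTop {z | C < z.im}) :
    ∃ g : ℂ → E, DifferentiableOn ℂ g upperHalf ∧
      ∀ z ∈ upperHalf, Tendsto (fun n => f n z) atTop (𝓝 (g z)) := by
  have key : ∀ z ∈ upperHalf, ∃ (U : Set ℂ) (h : ℂ → E), z ∈ U ∧ IsOpen U ∧
      DifferentiableOn ℂ h U ∧ ∀ w ∈ U, Tendsto (fun n => f n w) atTop (𝓝 (h w)) := by
    intro z hz
    have hz : 0 < z.im := hz
    -- a disc centred high up on the imaginary axis which contains `z`
    obtain ⟨Y, hCY, hY⟩ : ∃ Y : ℝ, C < Y ∧ ‖z‖ ^ 2 < 2 * z.im * Y := by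
      refine ⟨C + 1 + ‖z‖ ^ 2 / (2 * z.im), ?_, ?_⟩
      · have : 0 ≤ ‖z‖ ^ 2 / (2 * z.im) := by positivity
        linarith
      · have : 2 * z.im * (‖z‖ ^ 2 / (2 * z.im)) = ‖z‖ ^ 2 := by field_simp
        have h2 : 0 < 2 * z.im * (C + 1) := by positivity
        nlinarith
    have hzY : ‖z - Complex.I * Y‖ < Y := by
      refine lt_of_pow_lt_pow_left₀ 2 (hC.trans hCY).le ?_
      rw [Complex.sq_norm, Complex.normSq_apply] at hY ⊢
      simp only [Complex.sub_re, Complex.sub_im, Complex.mul_re, Complex.mul_im, Complex.I_re,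
        Complex.I_im, Complex.ofReal_re, Complex.ofReal_im]
      nlinarith
    -- The disc of radius `R` contains `z` and the disc of radius `Y - C`, where the sequence is
    -- uniformly Cauchy; `R < Y` keeps it away from the real axis.
    obtain ⟨R, hR1, hR2⟩ := exists_between (max_lt hzY (show Y - C < Y by linarith))
    have him : ∀ w : ℂ, ∀ s : ℝ, w ∈ Metric.ball (Complex.I * Y) s → Y - s < w.im := by
      intro w s hw
      have h1 := (Complex.abs_im_le_norm (w - Complex.I * Y)).trans_lt (mem_ball_iff_norm.1 hw)
      have h2 := (abs_lt.1 h1).1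
      simp at h2
      linarith
    have hsub : Metric.ball (Complex.I * Y) R ⊆ upperHalf := fun w hw => by
      have := him w R hw
      exact (by linarith : (0 : ℝ) < w.im)
    obtain ⟨h, hh, hlim⟩ := exists_differentiableOn_tendsto_of_uniformCauchySeqOn_ball
      (f := f) (a := Complex.I * Y) (r := Y - C) (R := R) (M := A / (Y - R)) (by linarith)
      ((le_max_right _ _).trans hR1.le) (fun n => (hf n).mono hsub)
      (fun n w hw => (hbd n w (hsub hw)).trans
        (div_le_div_of_nonneg_left hA (by linarith) (him w R hw).le))
      (hcauchy.mono fun w hw => by have := him w _ hw; exact (by linarith : C < w.im))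
    exact ⟨_, h, mem_ball_iff_norm.2 ((le_max_left _ _).trans_lt hR1), Metric.isOpen_ball, hh, hlim⟩
  choose! U h hzU hUo hhd hlim using key
  -- The local limits glue, since pointwise limits are unique.
  refine ⟨fun z => h z z, fun z hz => ?_, fun z hz => hlim z hz z (hzU z hz)⟩
  refine DifferentiableAt.differentiableWithinAt ?_
  refine (((hhd z hz).differentiableAt ((hUo z hz).mem_nhds (hzU z hz)))).congr_of_eventuallyEq ?_
  have hopen : IsOpen upperHalf := isOpen_lt continuous_const Complex.continuous_im
  filter_upwards [(hUo z hz).mem_nhds (hzU z hz), hopen.mem_nhds hz] with w hw hw'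
  exact tendsto_nhds_unique (hlim w hw' w (hzU w hw')) (hlim z hz w hw)

/-! ### The fixed point map: invariance of the half plane, bounds, contraction. -/

/-- One component of the right hand side of the fixed point equations. -/
noncomputable def fixedPointStep (ψ ζ : ℝ) (ξ x y : ℂ) : ℂ :=
  (ψ : ℂ) * (-ξ - y - (ζ : ℂ) ^ 2 * y / (1 - (ζ : ℂ) ^ 2 * x * y))⁻¹

/-- The right hand side of the fixed point equations. -/
noncomputable def fixedPointMap (ψ₁ ψ₂ ζ : ℝ) (ξ : ℂ) (z : ℂ × ℂ) : ℂ × ℂ :=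
  (fixedPointStep ψ₁ ζ ξ z.1 z.2, fixedPointStep ψ₂ ζ ξ z.2 z.1)

theorem fixedPointEqs_iff {ψ₁ ψ₂ ζ : ℝ} {ξ z₁ z₂ : ℂ} :
    FixedPointEqs ψ₁ ψ₂ ζ ξ z₁ z₂ ↔ fixedPointMap ψ₁ ψ₂ ζ ξ (z₁, z₂) = (z₁, z₂) := by
  simp only [FixedPointEqs, fixedPointMap, fixedPointStep, Prod.mk.injEq, mul_right_comm _ z₂ z₁]
  exact and_congr eq_comm eq_comm

theorem isOpen_upperHalf : IsOpen upperHalf := isOpen_lt continuous_const Complex.continuous_im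

theorem isPreconnected_upperHalf : IsPreconnected upperHalf :=
  (convex_halfSpace_im_gt 0).isPreconnected

/-- For nonzero `y` and denominator, the quotient is `ζ² / (1/y - ζ² x)`, and `1/y - ζ² x` has
nonpositive imaginary part. -/
theorem im_div_one_sub_nonneg {ζ : ℝ} {x y : ℂ} (hx : 0 ≤ x.im) (hy : 0 ≤ y.im) :
    0 ≤ ((ζ : ℂ) ^ 2 * y / (1 - (ζ : ℂ) ^ 2 * x * y)).im := by
  rw [← Complex.ofReal_pow, Complex.div_im, ← sub_div]
  refine div_nonneg ?_ (Complex.normSq_nonneg _)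
  simp only [Complex.mul_im, Complex.mul_re, Complex.sub_re, Complex.sub_im, Complex.one_re,
    Complex.one_im, Complex.ofReal_re, Complex.ofReal_im]
  have h : 0 ≤ ζ ^ 2 * (y.im + ζ ^ 2 * (y.re ^ 2 + y.im ^ 2) * x.im) := by positivity
  linarith

theorem im_fixedPointStep_denom_le {ζ : ℝ} {ξ x y : ℂ} (hx : 0 ≤ x.im) (hy : 0 ≤ y.im) :
    (-ξ - y - (ζ : ℂ) ^ 2 * y / (1 - (ζ : ℂ) ^ 2 * x * y)).im ≤ -ξ.im := by
  have := im_div_one_sub_nonneg (ζ := ζ) hx hy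
  rw [Complex.sub_im, Complex.sub_im, Complex.neg_im]
  linarith

theorem fixedPointStep_denom_ne_zero {ζ : ℝ} {ξ x y : ℂ} (hξ : 0 < ξ.im) (hx : 0 ≤ x.im)
    (hy : 0 ≤ y.im) : -ξ - y - (ζ : ℂ) ^ 2 * y / (1 - (ζ : ℂ) ^ 2 * x * y) ≠ 0 := by
  intro h
  have := im_fixedPointStep_denom_le (ζ := ζ) (ξ := ξ) hx hy
  rw [h, Complex.zero_im] at this
  linarith

theorem im_fixedPointStep_pos {ψ ζ : ℝ} {ξ x y : ℂ} (hψ : 0 < ψ) (hξ : 0 < ξ.im) (hx : 0 ≤ x.im)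
    (hy : 0 ≤ y.im) : 0 < (fixedPointStep ψ ζ ξ x y).im := by
  rw [fixedPointStep, Complex.im_ofReal_mul, Complex.inv_im]
  have := im_fixedPointStep_denom_le (ζ := ζ) (ξ := ξ) hx hy
  exact mul_pos hψ (div_pos (by linarith)
    (Complex.normSq_pos.2 (fixedPointStep_denom_ne_zero hξ hx hy)))

theorem norm_fixedPointStep_le {ψ ζ : ℝ} {ξ x y : ℂ} (hψ : 0 < ψ) (hξ : 0 < ξ.im) (hx : 0 ≤ x.im)
    (hy : 0 ≤ y.im) : ‖fixedPointStep ψ ζ ξ x y‖ ≤ ψ / ξ.im := by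
  rw [fixedPointStep, norm_mul, norm_inv, Complex.norm_real, Real.norm_of_nonneg hψ.le,
    ← div_eq_mul_inv]
  refine div_le_div_of_nonneg_left hψ.le hξ ?_
  have h := im_fixedPointStep_denom_le (ζ := ζ) (ξ := ξ) hx hy
  refine le_trans ?_ (Complex.abs_im_le_norm _)
  rw [abs_of_neg (by linarith)]
  linarith

theorem one_sub_mul_ne_zero {ζ : ℝ} {x y : ℂ} (hx : 0 < x.im) (hy : 0 < y.im) :
    1 - (ζ : ℂ) ^ 2 * x * y ≠ 0 := by
  intro h
  rw [← Complex.ofReal_pow] at h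
  have h1 := congrArg Complex.re h
  have h2 := congrArg Complex.im h
  simp only [Complex.mul_im, Complex.mul_re, Complex.sub_re, Complex.sub_im, Complex.one_re,
    Complex.one_im, Complex.ofReal_re, Complex.ofReal_im, Complex.zero_re, Complex.zero_im] at h1 h2
  -- Up to sign, the imaginary part of the equation multiplied by the conjugate of `y`.
  have h3 : y.im + ζ ^ 2 * (y.re ^ 2 + y.im ^ 2) * x.im = 0 := by
    linear_combination y.im * h1 - y.re * h2
  have h4 : 0 ≤ ζ ^ 2 * (y.re ^ 2 + y.im ^ 2) * x.im := by positivity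
  linarith

theorem differentiableOn_fixedPointStep {ψ ζ : ℝ} {x y : ℂ → ℂ}
    (hx : DifferentiableOn ℂ x upperHalf) (hy : DifferentiableOn ℂ y upperHalf)
    (hxm : MapsTo x upperHalf upperHalf) (hym : MapsTo y upperHalf upperHalf) :
    DifferentiableOn ℂ (fun ξ => fixedPointStep ψ ζ ξ (x ξ) (y ξ)) upperHalf := by
  refine DifferentiableOn.const_mul (DifferentiableOn.inv ?_ fun ξ hξ =>
    fixedPointStep_denom_ne_zero hξ (hxm hξ).le (hym hξ).le) _
  exact (differentiableOn_id.neg.sub hy).sub ((hy.const_mul _).div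
    (((hx.const_mul _).mul hy).const_sub 1) fun ξ hξ => one_sub_mul_ne_zero (hxm hξ) (hym hξ))

/-- This division-free form passes to limits without knowing that the limiting denominators are
nonzero. -/
theorem fixedPointStep_mul_eq {ψ ζ : ℝ} {ξ x y : ℂ} (hξ : 0 < ξ.im) (hx : 0 < x.im)
    (hy : 0 < y.im) :
    fixedPointStep ψ ζ ξ x y * ((-ξ - y) * (1 - (ζ : ℂ) ^ 2 * x * y) - (ζ : ℂ) ^ 2 * y) =
      ψ * (1 - (ζ : ℂ) ^ 2 * x * y) := by
  have hD := one_sub_mul_ne_zero (ζ := ζ) hx hy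
  have hw := fixedPointStep_denom_ne_zero (ζ := ζ) hξ hx.le hy.le
  have h : (-ξ - y) * (1 - (ζ : ℂ) ^ 2 * x * y) - (ζ : ℂ) ^ 2 * y =
      (-ξ - y - (ζ : ℂ) ^ 2 * y / (1 - (ζ : ℂ) ^ 2 * x * y)) * (1 - (ζ : ℂ) ^ 2 * x * y) := by
    rw [sub_mul (-ξ - y), div_mul_cancel₀ _ hD]
  rw [h, fixedPointStep, ← mul_assoc, mul_assoc (ψ : ℂ), inv_mul_cancel₀ hw, mul_one]

theorem eq_fixedPointStep_of_mul_eq {ψ ζ : ℝ} {ξ x y : ℂ} (hψ : ψ ≠ 0)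
    (h : x * ((-ξ - y) * (1 - (ζ : ℂ) ^ 2 * x * y) - (ζ : ℂ) ^ 2 * y) =
      ψ * (1 - (ζ : ℂ) ^ 2 * x * y)) : fixedPointStep ψ ζ ξ x y = x := by
  have hψ' : (ψ : ℂ) ≠ 0 := Complex.ofReal_ne_zero.2 hψ
  -- If this vanished, `h` would force `ζ² x y = 0`, whereas vanishing means `ζ² x y = 1`.
  have hD : 1 - (ζ : ℂ) ^ 2 * x * y ≠ 0 := by
    intro hD
    rw [hD] at h
    have : (1 : ℂ) = 0 := by linear_combination hD - h
    exact one_ne_zero this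
  have hw : x * (-ξ - y - (ζ : ℂ) ^ 2 * y / (1 - (ζ : ℂ) ^ 2 * x * y)) = ψ := by
    refine mul_right_cancel₀ hD ?_
    rw [← h, mul_assoc, sub_mul, div_mul_cancel₀ _ hD]
  have hw0 := right_ne_zero_of_mul (hw ▸ hψ')
  rw [fixedPointStep, ← hw, mul_assoc, mul_inv_cancel₀ hw0, mul_one]

/-- High up in the half plane each component is a contraction on a polydisc around the origin. -/
theorem norm_fixedPointStep_sub_le {ψ ζ A δ : ℝ} {ξ x y x' y' : ℂ} (hψ : 0 < ψ) (hA : ψ ≤ A)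
    (hξ : 8 * (1 + A) * (1 + ζ ^ 2) ≤ ξ.im) (hx : ‖x‖ ≤ A / ξ.im) (hy : ‖y‖ ≤ A / ξ.im)
    (hx' : ‖x'‖ ≤ A / ξ.im) (hy' : ‖y'‖ ≤ A / ξ.im) (hxx : ‖x - x'‖ ≤ δ) (hyy : ‖y - y'‖ ≤ δ) :
    ‖fixedPointStep ψ ζ ξ x y - fixedPointStep ψ ζ ξ x' y'‖ ≤ δ / 2 := by
  set t := ξ.im with ht
  set Z := ζ ^ 2 with hZ
  have hZ0 : 0 ≤ Z := sq_nonneg ζ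
  have hA0 : 0 < A := hψ.trans_le hA
  have hAZ : 0 ≤ A * Z := by positivity
  have ht8 : 8 ≤ t := by nlinarith
  have ht0 : 0 < t := by linarith
  have hδ : 0 ≤ δ := (norm_nonneg _).trans hxx
  set r := A / t with hr
  have hr0 : 0 ≤ r := by positivity
  have hrZ : r * (1 + Z) ≤ 1 / 8 := by
    rw [hr, div_mul_eq_mul_div, div_le_iff₀ ht0]
    nlinarith
  have hrZ0 : 0 ≤ r * Z := by positivity
  have hr8 : r ≤ 1 / 8 := by nlinarith
  have hr2 : Z * r * r ≤ 1 / 64 := by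
    have : r * Z ≤ 1 / 8 := by nlinarith
    nlinarith
  have hζ : ‖(ζ : ℂ) ^ 2‖ = Z := by
    rw [norm_pow, Complex.norm_real, Real.norm_eq_abs, sq_abs]
  have hprod : ∀ u v : ℂ, ‖u‖ ≤ r → ‖v‖ ≤ r → ‖(ζ : ℂ) ^ 2 * u * v‖ ≤ 1 / 64 := by
    intro u v hu hv
    rw [norm_mul, norm_mul, hζ]
    exact le_trans (by gcongr) hr2
  have hD : ∀ u v : ℂ, ‖u‖ ≤ r → ‖v‖ ≤ r → 1 / 2 ≤ ‖1 - (ζ : ℂ) ^ 2 * u * v‖ := by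
    intro u v hu hv
    have h1 := norm_sub_norm_le 1 ((ζ : ℂ) ^ 2 * u * v)
    have h2 := hprod u v hu hv
    rw [norm_one] at h1
    linarith
  have hw : ∀ u v : ℂ, ‖u‖ ≤ r → ‖v‖ ≤ r →
      t / 2 ≤ ‖-ξ - v - (ζ : ℂ) ^ 2 * v / (1 - (ζ : ℂ) ^ 2 * u * v)‖ := by
    intro u v hu hv
    have h1 : ‖(ζ : ℂ) ^ 2 * v / (1 - (ζ : ℂ) ^ 2 * u * v)‖ ≤ Z * r / (1 / 2) := by
      rw [norm_div, norm_mul, hζ]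
      have := hD u v hu hv
      gcongr
    have h2 := norm_sub_norm_le (-ξ - v) ((ζ : ℂ) ^ 2 * v / (1 - (ζ : ℂ) ^ 2 * u * v))
    have h3 := norm_sub_norm_le (-ξ) v
    rw [norm_neg] at h3
    have h4 : t ≤ ‖ξ‖ := (le_abs_self _).trans (Complex.abs_im_le_norm ξ)
    linarith
  have hDxy := hD x y hx hy
  have hDxy' := hD x' y' hx' hy'
  have hwxy := hw x y hx hy
  have hwxy' := hw x' y' hx' hy'
  set D := 1 - (ζ : ℂ) ^ 2 * x * y with hDdef
  set D' := 1 - (ζ : ℂ) ^ 2 * x' * y' with hDdef'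
  have hD0 : D ≠ 0 := norm_pos_iff.1 (by linarith)
  have hD0' : D' ≠ 0 := norm_pos_iff.1 (by linarith)
  have hu : ‖(ζ : ℂ) ^ 2 * y / D - (ζ : ℂ) ^ 2 * y' / D'‖ ≤ 8 * Z * δ := by
    have h : (ζ : ℂ) ^ 2 * y / D - (ζ : ℂ) ^ 2 * y' / D' =
        (ζ : ℂ) ^ 2 * ((y - y') + (ζ : ℂ) ^ 2 * y * y' * (x - x')) / (D * D') := by
      rw [div_sub_div _ _ hD0 hD0']
      congr 1
      rw [hDdef, hDdef']
      ring
    have hnum : ‖(y - y') + (ζ : ℂ) ^ 2 * y * y' * (x - x')‖ ≤ 2 * δ := by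
      refine (norm_add_le _ _).trans ?_
      rw [norm_mul]
      have := mul_le_mul (hprod y y' hy hy') hxx (norm_nonneg _) (by norm_num)
      linarith
    rw [h, norm_div, norm_mul, norm_mul, hζ, div_le_iff₀ (by positivity)]
    have h4 : 1 / 4 ≤ ‖D‖ * ‖D'‖ := by nlinarith
    have h5 : Z * ‖(y - y') + (ζ : ℂ) ^ 2 * y * y' * (x - x')‖ ≤ Z * (2 * δ) := by gcongr
    have h6 : 8 * Z * δ * (1 / 4) ≤ 8 * Z * δ * (‖D‖ * ‖D'‖) := by gcongr
    linarith
  have hfs : fixedPointStep ψ ζ ξ x y = ψ * (-ξ - y - (ζ : ℂ) ^ 2 * y / D)⁻¹ := rfl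
  have hfs' : fixedPointStep ψ ζ ξ x' y' = ψ * (-ξ - y' - (ζ : ℂ) ^ 2 * y' / D')⁻¹ := rfl
  rw [hfs, hfs', ← mul_sub]
  set w := -ξ - y - (ζ : ℂ) ^ 2 * y / D with hwdef
  set w' := -ξ - y' - (ζ : ℂ) ^ 2 * y' / D' with hwdef'
  have hw0 : w ≠ 0 := norm_pos_iff.1 (by linarith)
  have hw0' : w' ≠ 0 := norm_pos_iff.1 (by linarith)
  have hww : ‖w' - w‖ ≤ 8 * (1 + Z) * δ := by
    have h : w' - w = (y - y') + ((ζ : ℂ) ^ 2 * y / D - (ζ : ℂ) ^ 2 * y' / D') := by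
      rw [hwdef, hwdef']
      ring
    rw [h]
    refine (norm_add_le _ _).trans ?_
    linarith
  rw [inv_sub_inv hw0 hw0', norm_mul, norm_div, norm_mul, Complex.norm_real,
    Real.norm_of_nonneg hψ.le, ← mul_div_assoc, div_le_iff₀ (by positivity)]
  -- The difference is at most `ψ · 8 (1 + Z) δ / (t / 2)²`; as `ψ ≤ r t` and `r (1 + Z) ≤ 1 / 8`,
  -- this is at most `4 δ / t ≤ δ / 2`.
  have hψr : ψ ≤ r * t := by
    rw [hr, div_mul_cancel₀ _ ht0.ne']
    exact hA
  have h7 : ψ * ‖w' - w‖ ≤ (r * t) * (8 * (1 + Z) * δ) := by gcongr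
  have h8 : (t / 2) * (t / 2) ≤ ‖w‖ * ‖w'‖ := by gcongr
  have h9 : δ / 2 * ((t / 2) * (t / 2)) ≤ δ / 2 * (‖w‖ * ‖w'‖) := by gcongr
  have h10 : (r * (1 + Z)) * (8 * t * δ) ≤ 1 / 8 * (8 * t * δ) := by gcongr
  have h11 : 8 * (t * δ) ≤ t * (t * δ) := by gcongr
  linarith

theorem norm_fixedPointMap_sub_le {ψ₁ ψ₂ ζ : ℝ} {ξ : ℂ} {z z' : ℂ × ℂ} (h₁ : 0 < ψ₁) (h₂ : 0 < ψ₂)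
    (hξ : 8 * (1 + (ψ₁ + ψ₂)) * (1 + ζ ^ 2) ≤ ξ.im) (hz : ‖z‖ ≤ (ψ₁ + ψ₂) / ξ.im)
    (hz' : ‖z'‖ ≤ (ψ₁ + ψ₂) / ξ.im) :
    ‖fixedPointMap ψ₁ ψ₂ ζ ξ z - fixedPointMap ψ₁ ψ₂ ζ ξ z'‖ ≤ ‖z - z'‖ / 2 := by
  have a := (norm_fst_le z).trans hz
  have b := (norm_snd_le z).trans hz
  have a' := (norm_fst_le z').trans hz'
  have b' := (norm_snd_le z').trans hz'
  refine norm_prod_le_iff.2 ⟨?_, ?_⟩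
  · exact norm_fixedPointStep_sub_le h₁ (by linarith) hξ a b a' b' (norm_fst_le (z - z'))
      (norm_snd_le (z - z'))
  · exact norm_fixedPointStep_sub_le h₂ (by linarith) hξ b a b' a' (norm_snd_le (z - z'))
      (norm_fst_le (z - z'))

/-- On the imaginary axis the fixed point map preserves pairs of imaginary numbers. -/
theorem re_fixedPointStep_eq_zero {ψ ζ : ℝ} {ξ x y : ℂ} (hξ : ξ.re = 0) (hx : x.re = 0)
    (hy : y.re = 0) : (fixedPointStep ψ ζ ξ x y).re = 0 := by
  rw [fixedPointStep, ← Complex.ofReal_pow]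
  simp [-Complex.ofReal_pow, Complex.div_re, Complex.div_im, Complex.mul_re, Complex.mul_im, Complex.inv_re, hξ, hx, hy]

/-! ### Iterates, existence and uniqueness of the pair. -/

/-- The iterates of the fixed point map, started at the origin. -/
noncomputable def fixedPointIterate (ψ₁ ψ₂ ζ : ℝ) (n : ℕ) (ξ : ℂ) : ℂ × ℂ :=
  (fixedPointMap ψ₁ ψ₂ ζ ξ)^[n] 0

theorem fixedPointIterate_succ (ψ₁ ψ₂ ζ : ℝ) (n : ℕ) (ξ : ℂ) :
    fixedPointIterate ψ₁ ψ₂ ζ (n + 1) ξ =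
      fixedPointMap ψ₁ ψ₂ ζ ξ (fixedPointIterate ψ₁ ψ₂ ζ n ξ) :=
  Function.iterate_succ_apply' _ _ _

section
variable {ψ₁ ψ₂ ζ : ℝ}

theorem im_fixedPointIterate_nonneg (h₁ : 0 < ψ₁) (h₂ : 0 < ψ₂) {ξ : ℂ} (hξ : 0 < ξ.im) (n : ℕ) :
    0 ≤ (fixedPointIterate ψ₁ ψ₂ ζ n ξ).1.im ∧ 0 ≤ (fixedPointIterate ψ₁ ψ₂ ζ n ξ).2.im := by
  induction n with
  | zero => simp [fixedPointIterate]
  | succ n ih =>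
    rw [fixedPointIterate_succ]
    exact ⟨(im_fixedPointStep_pos h₁ hξ ih.1 ih.2).le, (im_fixedPointStep_pos h₂ hξ ih.2 ih.1).le⟩

theorem im_fixedPointIterate_pos (h₁ : 0 < ψ₁) (h₂ : 0 < ψ₂) {ξ : ℂ} (hξ : 0 < ξ.im) (n : ℕ) :
    0 < (fixedPointIterate ψ₁ ψ₂ ζ (n + 1) ξ).1.im ∧
      0 < (fixedPointIterate ψ₁ ψ₂ ζ (n + 1) ξ).2.im := by
  have h := im_fixedPointIterate_nonneg (ζ := ζ) h₁ h₂ hξ n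
  rw [fixedPointIterate_succ]
  exact ⟨im_fixedPointStep_pos h₁ hξ h.1 h.2, im_fixedPointStep_pos h₂ hξ h.2 h.1⟩

theorem norm_fixedPointIterate_le (h₁ : 0 < ψ₁) (h₂ : 0 < ψ₂) {ξ : ℂ} (hξ : 0 < ξ.im) (n : ℕ) :
    ‖(fixedPointIterate ψ₁ ψ₂ ζ n ξ).1‖ ≤ ψ₁ / ξ.im ∧
      ‖(fixedPointIterate ψ₁ ψ₂ ζ n ξ).2‖ ≤ ψ₂ / ξ.im := by
  cases n with
  | zero =>
    simp only [fixedPointIterate, Function.iterate_zero, id, Prod.fst_zero, Prod.snd_zero,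
      norm_zero]
    exact ⟨by positivity, by positivity⟩
  | succ n =>
    have h := im_fixedPointIterate_nonneg (ζ := ζ) h₁ h₂ hξ n
    rw [fixedPointIterate_succ]
    exact ⟨norm_fixedPointStep_le h₁ hξ h.1 h.2, norm_fixedPointStep_le h₂ hξ h.2 h.1⟩

theorem norm_le_add_div_of_le (h₁ : 0 < ψ₁) (h₂ : 0 < ψ₂) {t : ℝ} (ht : 0 < t) {z : ℂ × ℂ}
    (hz₁ : ‖z.1‖ ≤ ψ₁ / t) (hz₂ : ‖z.2‖ ≤ ψ₂ / t) : ‖z‖ ≤ (ψ₁ + ψ₂) / t := by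
  refine norm_prod_le_iff.2 ⟨hz₁.trans ?_, hz₂.trans ?_⟩ <;> gcongr <;> linarith

theorem norm_fixedPointIterate_le_add (h₁ : 0 < ψ₁) (h₂ : 0 < ψ₂) {ξ : ℂ} (hξ : 0 < ξ.im) (n : ℕ) :
    ‖fixedPointIterate ψ₁ ψ₂ ζ n ξ‖ ≤ (ψ₁ + ψ₂) / ξ.im :=
  norm_le_add_div_of_le h₁ h₂ hξ (norm_fixedPointIterate_le h₁ h₂ hξ n).1
    (norm_fixedPointIterate_le h₁ h₂ hξ n).2

theorem differentiableOn_fixedPointIterate (h₁ : 0 < ψ₁) (h₂ : 0 < ψ₂) (n : ℕ) :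
    DifferentiableOn ℂ (fixedPointIterate ψ₁ ψ₂ ζ (n + 1)) upperHalf := by
  induction n with
  | zero =>
    -- The starting value `0` is on the boundary, outside the scope of
    -- `differentiableOn_fixedPointStep`; the first iterate is explicitly `-ψ / ξ`.
    have hstep : ∀ ψ : ℝ, DifferentiableOn ℂ (fun ξ => fixedPointStep ψ ζ ξ 0 0) upperHalf := by
      intro ψ
      simp only [fixedPointStep, mul_zero, zero_div, sub_zero]
      refine (differentiableOn_id.neg.inv fun ξ hξ => neg_ne_zero.2 ?_).const_mul _
      rintro rfl
      exact lt_irrefl (0 : ℝ) hξ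
    exact (hstep ψ₁).prodMk (hstep ψ₂)
  | succ n ih =>
    have hm₁ : MapsTo (fun ξ => (fixedPointIterate ψ₁ ψ₂ ζ (n + 1) ξ).1) upperHalf upperHalf :=
      fun ξ hξ => (im_fixedPointIterate_pos h₁ h₂ hξ n).1
    have hm₂ : MapsTo (fun ξ => (fixedPointIterate ψ₁ ψ₂ ζ (n + 1) ξ).2) upperHalf upperHalf :=
      fun ξ hξ => (im_fixedPointIterate_pos h₁ h₂ hξ n).2
    have h := (differentiableOn_fixedPointStep (ψ := ψ₁) (ζ := ζ) ih.fst ih.snd hm₁ hm₂).prodMk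
      (differentiableOn_fixedPointStep (ψ := ψ₂) (ζ := ζ) ih.snd ih.fst hm₂ hm₁)
    exact h.congr fun ξ _ => fixedPointIterate_succ ψ₁ ψ₂ ζ (n + 1) ξ

/-- All iterates lie within distance `1` of each other, and `N` common steps halve that distance `N`
times. -/
theorem norm_fixedPointIterate_sub_le (h₁ : 0 < ψ₁) (h₂ : 0 < ψ₂) {ξ : ℂ}
    (hξ : 8 * (1 + (ψ₁ + ψ₂)) * (1 + ζ ^ 2) ≤ ξ.im) (N m n : ℕ) :
    ‖fixedPointIterate ψ₁ ψ₂ ζ (N + m) ξ - fixedPointIterate ψ₁ ψ₂ ζ (N + n) ξ‖ ≤ (1 / 2) ^ N := by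
  have hA : 0 < ψ₁ + ψ₂ := by positivity
  have hAξ : 8 * (1 + (ψ₁ + ψ₂)) ≤ ξ.im := by nlinarith [sq_nonneg ζ]
  have hξ0 : 0 < ξ.im := by linarith
  have hbd := norm_fixedPointIterate_le_add (ζ := ζ) h₁ h₂ hξ0
  induction N with
  | zero =>
    have h := (norm_sub_le _ _).trans (add_le_add (hbd (0 + m)) (hbd (0 + n)))
    have hle : (ψ₁ + ψ₂) / ξ.im ≤ 1 / 2 := by
      rw [div_le_iff₀ hξ0]
      linarith
    rw [pow_zero]
    linarith
  | succ N ih =>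
    rw [Nat.add_right_comm N 1 m, Nat.add_right_comm N 1 n, fixedPointIterate_succ,
      fixedPointIterate_succ]
    refine (norm_fixedPointMap_sub_le h₁ h₂ hξ (hbd _) (hbd _)).trans ?_
    rw [pow_succ]
    linarith

theorem uniformCauchySeqOn_fixedPointIterate (h₁ : 0 < ψ₁) (h₂ : 0 < ψ₂) :
    UniformCauchySeqOn (fun n => fixedPointIterate ψ₁ ψ₂ ζ (n + 1)) atTop
      {ξ | 8 * (1 + (ψ₁ + ψ₂)) * (1 + ζ ^ 2) < ξ.im} := by
  rw [Metric.uniformCauchySeqOn_iff]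
  intro ε hε
  obtain ⟨N, hN⟩ := exists_pow_lt_of_lt_one hε (by norm_num : (1 / 2 : ℝ) < 1)
  refine ⟨N, fun m hm n hn ξ hξ => ?_⟩
  obtain ⟨m, rfl⟩ := Nat.exists_eq_add_of_le hm
  obtain ⟨n, rfl⟩ := Nat.exists_eq_add_of_le hn
  rw [dist_eq_norm]
  exact (norm_fixedPointIterate_sub_le h₁ h₂ (le_of_lt hξ) N (m + 1) (n + 1)).trans_lt hN

theorem FixedPointEqs.eq_of_norm_le (h₁ : 0 < ψ₁) (h₂ : 0 < ψ₂) {ξ z₁ z₂ w₁ w₂ : ℂ}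
    (hξ : 8 * (1 + (ψ₁ + ψ₂)) * (1 + ζ ^ 2) ≤ ξ.im) (hz : FixedPointEqs ψ₁ ψ₂ ζ ξ z₁ z₂)
    (hw : FixedPointEqs ψ₁ ψ₂ ζ ξ w₁ w₂) (hz₁ : ‖z₁‖ ≤ ψ₁ / ξ.im) (hz₂ : ‖z₂‖ ≤ ψ₂ / ξ.im)
    (hw₁ : ‖w₁‖ ≤ ψ₁ / ξ.im) (hw₂ : ‖w₂‖ ≤ ψ₂ / ξ.im) : z₁ = w₁ ∧ z₂ = w₂ := by
  have hξ0 : 0 < ξ.im := lt_of_lt_of_le (by positivity) hξ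
  have h := norm_fixedPointMap_sub_le h₁ h₂ hξ
    (norm_le_add_div_of_le (z := (z₁, z₂)) h₁ h₂ hξ0 hz₁ hz₂)
    (norm_le_add_div_of_le (z := (w₁, w₂)) h₁ h₂ hξ0 hw₁ hw₂)
  rw [fixedPointEqs_iff.1 hz, fixedPointEqs_iff.1 hw] at h
  have h0 : ‖(z₁, z₂) - (w₁, w₂)‖ = 0 := by
    have := norm_nonneg ((z₁, z₂) - (w₁, w₂))
    linarith
  exact Prod.mk.inj (sub_eq_zero.1 (norm_eq_zero.1 h0))

theorem fixedPointMap_eq_of_tendsto (h₁ : 0 < ψ₁) (h₂ : 0 < ψ₂) {ξ : ℂ} (hξ : 0 < ξ.im) {z : ℂ × ℂ}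
    (hz : Tendsto (fun n => fixedPointIterate ψ₁ ψ₂ ζ (n + 1) ξ) atTop (𝓝 z)) :
    fixedPointMap ψ₁ ψ₂ ζ ξ z = z := by
  have hz' := (tendsto_add_atTop_iff_nat 1).2 hz
  have hfst := (continuous_fst.tendsto z).comp hz
  have hsnd := (continuous_snd.tendsto z).comp hz
  have hpos := im_fixedPointIterate_pos (ζ := ζ) h₁ h₂ hξ
  have key : ∀ (ψ : ℝ) (x y x' : ℕ → ℂ) (X Y : ℂ), ψ ≠ 0 → (∀ n, 0 < (x n).im) →
      (∀ n, 0 < (y n).im) → (∀ n, x' n = fixedPointStep ψ ζ ξ (x n) (y n)) →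
      Tendsto x atTop (𝓝 X) → Tendsto y atTop (𝓝 Y) → Tendsto x' atTop (𝓝 X) →
      fixedPointStep ψ ζ ξ X Y = X := by
    intro ψ x y x' X Y hψ hx hy hx' hX hY hX'
    refine eq_fixedPointStep_of_mul_eq hψ ?_
    have hD := ((hX.const_mul ((ζ : ℂ) ^ 2)).mul hY).const_sub 1
    refine tendsto_nhds_unique (hX'.mul (((hY.const_sub (-ξ)).mul hD).sub
      (hY.const_mul ((ζ : ℂ) ^ 2)))) ((hD.const_mul (ψ : ℂ)).congr fun n => ?_)
    rw [hx' n]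
    exact (fixedPointStep_mul_eq hξ (hx n) (hy n)).symm
  refine Prod.ext ?_ ?_
  · exact key ψ₁ _ _ _ z.1 z.2 h₁.ne' (fun n => (hpos n).1) (fun n => (hpos n).2)
      (fun n => congrArg Prod.fst (fixedPointIterate_succ ψ₁ ψ₂ ζ (n + 1) ξ)) hfst hsnd
      ((continuous_fst.tendsto z).comp hz')
  · exact key ψ₂ _ _ _ z.2 z.1 h₂.ne' (fun n => (hpos n).2) (fun n => (hpos n).1)
      (fun n => congrArg Prod.snd (fixedPointIterate_succ ψ₁ ψ₂ ζ (n + 1) ξ)) hsnd hfst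
      ((continuous_snd.tendsto z).comp hz')

theorem re_fixedPointIterate_eq_zero {ξ : ℂ} (hξ : ξ.re = 0) (n : ℕ) :
    (fixedPointIterate ψ₁ ψ₂ ζ n ξ).1.re = 0 ∧ (fixedPointIterate ψ₁ ψ₂ ζ n ξ).2.re = 0 := by
  induction n with
  | zero => simp [fixedPointIterate]
  | succ n ih =>
    rw [fixedPointIterate_succ]
    exact ⟨re_fixedPointStep_eq_zero hξ ih.1 ih.2, re_fixedPointStep_eq_zero hξ ih.2 ih.1⟩

/-- The clause on real parts is recorded for this particular pair, built from iterates that are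
imaginary on the axis; uniqueness later transfers it to `nuPair`. -/
theorem exists_isNuPair (h₁ : 0 < ψ₁) (h₂ : 0 < ψ₂) (ζ : ℝ) :
    ∃ ν : (ℂ → ℂ) × (ℂ → ℂ), IsNuPair ψ₁ ψ₂ ζ ν ∧
      ∀ ξ ∈ upperHalf, ξ.re = 0 → (ν.1 ξ).re = 0 ∧ (ν.2 ξ).re = 0 := by
  obtain ⟨g, hg, hlim⟩ := exists_differentiableOn_tendsto_upperHalf
    (f := fun n => fixedPointIterate ψ₁ ψ₂ ζ (n + 1)) (A := ψ₁ + ψ₂)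
    (C := 8 * (1 + (ψ₁ + ψ₂)) * (1 + ζ ^ 2)) (by positivity) (by positivity)
    (differentiableOn_fixedPointIterate h₁ h₂)
    (fun n ξ hξ => norm_fixedPointIterate_le_add h₁ h₂ hξ (n + 1))
    (uniformCauchySeqOn_fixedPointIterate h₁ h₂)
  have hfst : ∀ ξ ∈ upperHalf,
      Tendsto (fun n => (fixedPointIterate ψ₁ ψ₂ ζ (n + 1) ξ).1) atTop (𝓝 (g ξ).1) :=
    fun ξ hξ => (continuous_fst.tendsto _).comp (hlim ξ hξ)
  have hsnd : ∀ ξ ∈ upperHalf,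
      Tendsto (fun n => (fixedPointIterate ψ₁ ψ₂ ζ (n + 1) ξ).2) atTop (𝓝 (g ξ).2) :=
    fun ξ hξ => (continuous_snd.tendsto _).comp (hlim ξ hξ)
  have hfix : ∀ ξ ∈ upperHalf, fixedPointMap ψ₁ ψ₂ ζ ξ (g ξ) = g ξ :=
    fun ξ hξ => fixedPointMap_eq_of_tendsto h₁ h₂ hξ (hlim ξ hξ)
  have him : ∀ ξ ∈ upperHalf, 0 ≤ (g ξ).1.im ∧ 0 ≤ (g ξ).2.im := fun ξ hξ =>
    ⟨ge_of_tendsto' ((Complex.continuous_im.tendsto _).comp (hfst ξ hξ)) fun n =>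
      (im_fixedPointIterate_nonneg h₁ h₂ hξ (n + 1)).1,
    ge_of_tendsto' ((Complex.continuous_im.tendsto _).comp (hsnd ξ hξ)) fun n =>
      (im_fixedPointIterate_nonneg h₁ h₂ hξ (n + 1)).2⟩
  have heqs : ∀ ξ ∈ upperHalf, FixedPointEqs ψ₁ ψ₂ ζ ξ (g ξ).1 (g ξ).2 :=
    fun ξ hξ => fixedPointEqs_iff.2 (hfix ξ hξ)
  have hbd : ∀ ξ ∈ upperHalf, ‖(g ξ).1‖ ≤ ψ₁ / ξ.im ∧ ‖(g ξ).2‖ ≤ ψ₂ / ξ.im := fun ξ hξ =>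
    ⟨le_of_tendsto' (hfst ξ hξ).norm fun n => (norm_fixedPointIterate_le h₁ h₂ hξ (n + 1)).1,
    le_of_tendsto' (hsnd ξ hξ).norm fun n => (norm_fixedPointIterate_le h₁ h₂ hξ (n + 1)).2⟩
  refine ⟨(fun ξ => (g ξ).1, fun ξ => (g ξ).2), ⟨fun ξ hξ => ?_, fun ξ hξ => ?_,
    hg.fst.analyticOnNhd isOpen_upperHalf, hg.snd.analyticOnNhd isOpen_upperHalf, heqs,
    8 * (1 + (ψ₁ + ψ₂)) * (1 + ζ ^ 2), by positivity, fun ξ hξ => ?_⟩, fun ξ hξ hre => ⟨?_, ?_⟩⟩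
  -- The limit only inherits `0 ≤ Im`; strictness comes from its being a fixed point.
  · have h := im_fixedPointStep_pos (ζ := ζ) h₁ hξ (him ξ hξ).1 (him ξ hξ).2
    rwa [show fixedPointStep ψ₁ ζ ξ (g ξ).1 (g ξ).2 = (g ξ).1 from
      congrArg Prod.fst (hfix ξ hξ)] at h
  · have h := im_fixedPointStep_pos (ζ := ζ) h₂ hξ (him ξ hξ).2 (him ξ hξ).1
    rwa [show fixedPointStep ψ₂ ζ ξ (g ξ).2 (g ξ).1 = (g ξ).2 from
      congrArg Prod.snd (hfix ξ hξ)] at h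
  · have hξ0 : ξ ∈ upperHalf := lt_trans (by positivity) hξ
    exact ⟨hbd ξ hξ0, fun z₁ z₂ hz hz₁ hz₂ => hz.eq_of_norm_le h₁ h₂ hξ.le (heqs ξ hξ0) hz₁ hz₂
      (hbd ξ hξ0).1 (hbd ξ hξ0).2⟩
  · exact tendsto_nhds_unique ((Complex.continuous_re.tendsto _).comp (hfst ξ hξ))
      (tendsto_const_nhds.congr fun n => (re_fixedPointIterate_eq_zero hre (n + 1)).1.symm)
  · exact tendsto_nhds_unique ((Complex.continuous_re.tendsto _).comp (hsnd ξ hξ))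
      (tendsto_const_nhds.congr fun n => (re_fixedPointIterate_eq_zero hre (n + 1)).2.symm)

/-- High up, `ν'` obeys the bounds under which `ν` is the only solution, so the pairs agree on an
open set; analyticity does the rest. -/
theorem IsNuPair.eqOn {ν ν' : (ℂ → ℂ) × (ℂ → ℂ)} (h : IsNuPair ψ₁ ψ₂ ζ ν)
    (h' : IsNuPair ψ₁ ψ₂ ζ ν') : EqOn ν'.1 ν.1 upperHalf ∧ EqOn ν'.2 ν.2 upperHalf := by
  obtain ⟨C, hC0, hC⟩ := h.unique_large
  obtain ⟨C', -, hC'⟩ := h'.unique_large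
  have heq : ∀ ξ : ℂ, max C C' < ξ.im → ν'.1 ξ = ν.1 ξ ∧ ν'.2 ξ = ν.2 ξ := by
    intro ξ hξ
    have hb := (hC' ξ ((le_max_right _ _).trans_lt hξ)).1
    exact (hC ξ ((le_max_left _ _).trans_lt hξ)).2 _ _
      (h'.eqs ξ (hC0.trans ((le_max_left _ _).trans_lt hξ))) hb.1 hb.2
  have hmem : Complex.I * ((max C C' + 1 : ℝ) : ℂ) ∈ {ξ : ℂ | max C C' < ξ.im} := by
    rw [mem_ofPred_eq, Complex.I_mul_im, Complex.ofReal_re]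
    exact lt_add_one _
  have hopen : IsOpen {ξ : ℂ | max C C' < ξ.im} := isOpen_lt continuous_const Complex.continuous_im
  have hmem' : Complex.I * ((max C C' + 1 : ℝ) : ℂ) ∈ upperHalf :=
    (hC0.trans_le (le_max_left _ _)).trans hmem
  constructor
  · refine h'.analytic_fst.eqOn_of_preconnected_of_eventuallyEq h.analytic_fst
      isPreconnected_upperHalf hmem' ?_
    filter_upwards [hopen.mem_nhds hmem] with ξ hξ using (heq ξ hξ).1
  · refine h'.analytic_snd.eqOn_of_preconnected_of_eventuallyEq h.analytic_snd
      isPreconnected_upperHalf hmem' ?_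
    filter_upwards [hopen.mem_nhds hmem] with ξ hξ using (heq ξ hξ).2

end

theorem isNuPair_nuPair {ψ₁ ψ₂ : ℝ} (h₁ : 0 < ψ₁) (h₂ : 0 < ψ₂) (ζ : ℝ) :
    IsNuPair ψ₁ ψ₂ ζ (nuPair ψ₁ ψ₂ ζ) :=
  Classical.epsilon_spec ((exists_isNuPair h₁ h₂ ζ).imp fun _ h => h.1)

/-! ### The real equation on the imaginary axis, and monotonicity. -/

/-- The relation satisfied by `-ν₁ν₂` at the point `i s` of the imaginary axis. -/
def NegProdEq (ψ₁ ψ₂ ζ s q : ℝ) : Prop :=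
  q + ζ ^ 2 * q / (1 + ζ ^ 2 * q) < ψ₁ ∧ q + ζ ^ 2 * q / (1 + ζ ^ 2 * q) < ψ₂ ∧
    s ^ 2 * q = (ψ₁ - (q + ζ ^ 2 * q / (1 + ζ ^ 2 * q))) * (ψ₂ - (q + ζ ^ 2 * q / (1 + ζ ^ 2 * q)))

/-- With all arguments imaginary the product `x y` is `-p q`, and the equation becomes real: `p (s +
q + ζ² q / (1 + ζ² p q)) = ψ`. -/
theorem mul_eq_sub_of_eq_fixedPointStep {ψ ζ s p q : ℝ} (hs : 0 < s) (hp : 0 < p) (hq : 0 < q)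
    (h : fixedPointStep ψ ζ (Complex.I * s) (Complex.I * p) (Complex.I * q) = Complex.I * p) :
    s * p = ψ - (p * q + ζ ^ 2 * (p * q) / (1 + ζ ^ 2 * (p * q))) := by
  have him : ∀ t : ℝ, 0 < t → 0 < (Complex.I * t).im := fun t ht => by simpa using ht
  have hm := fixedPointStep_mul_eq (ψ := ψ) (ζ := ζ) (him s hs) (him p hp) (him q hq)
  rw [h] at hm
  have hr : p * ((s + q) * (1 + ζ ^ 2 * (p * q)) + ζ ^ 2 * q) = ψ * (1 + ζ ^ 2 * (p * q)) := by
    have h2 : ((p * ((s + q) * (1 + ζ ^ 2 * (p * q)) + ζ ^ 2 * q) : ℝ) : ℂ) =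
        ((ψ * (1 + ζ ^ 2 * (p * q)) : ℝ) : ℂ) := by
      push_cast
      linear_combination hm + ((p : ℂ) * (s + q) * (1 + ζ ^ 2 * p * q * (1 - Complex.I ^ 2)) +
        ζ ^ 2 * p * q - ψ * ζ ^ 2 * p * q) * Complex.I_sq
    exact_mod_cast h2
  have hD : 0 < 1 + ζ ^ 2 * (p * q) := by positivity
  field_simp
  linarith

theorem exists_negProdEq {ψ₁ ψ₂ : ℝ} (h₁ : 0 < ψ₁) (h₂ : 0 < ψ₂) (ζ : ℝ) {s : ℝ} (hs : 0 < s) :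
    ∃ q : ℝ, 0 < q ∧ NegProdEq ψ₁ ψ₂ ζ s q ∧
      (nuPair ψ₁ ψ₂ ζ).1 (Complex.I * s) * (nuPair ψ₁ ψ₂ ζ).2 (Complex.I * s) = ((-q : ℝ) : ℂ) := by
  obtain ⟨ν, hν, hre⟩ := exists_isNuPair h₁ h₂ ζ
  have hmem : Complex.I * (s : ℂ) ∈ upperHalf := by simpa [upperHalf] using hs
  have hre' := hre _ hmem (by simp)
  have hnu := isNuPair_nuPair h₁ h₂ ζ
  have heq := hν.eqOn hnu
  rw [← heq.1 hmem, ← heq.2 hmem] at hre'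
  have hp : 0 < ((nuPair ψ₁ ψ₂ ζ).1 (Complex.I * s)).im := hnu.mapsTo_fst hmem
  have hq : 0 < ((nuPair ψ₁ ψ₂ ζ).2 (Complex.I * s)).im := hnu.mapsTo_snd hmem
  have hfix := fixedPointEqs_iff.1 (hnu.eqs _ hmem)
  set x := (nuPair ψ₁ ψ₂ ζ).1 (Complex.I * s)
  set y := (nuPair ψ₁ ψ₂ ζ).2 (Complex.I * s)
  have hx : x = Complex.I * x.im := Complex.ext (by simpa using hre'.1) (by simp)
  have hy : y = Complex.I * y.im := Complex.ext (by simpa using hre'.2) (by simp)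
  generalize x.im = p at hx hp
  generalize y.im = r at hy hq
  rw [hx, hy] at hfix ⊢
  have e₁ := mul_eq_sub_of_eq_fixedPointStep hs hp hq (congrArg Prod.fst hfix)
  have e₂ := mul_eq_sub_of_eq_fixedPointStep hs hq hp (congrArg Prod.snd hfix)
  rw [mul_comm r p] at e₂
  have hsp : 0 < s * p := by positivity
  have hsr : 0 < s * r := by positivity
  refine ⟨p * r, by positivity, ⟨by linarith, by linarith, ?_⟩, ?_⟩
  · rw [← e₁, ← e₂]
    ring
  · push_cast
    linear_combination (p * r : ℂ) * Complex.I_sq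

/-- The solution of `NegProdEq` is non-increasing in `s`. -/
theorem NegProdEq.le_of_le {ψ₁ ψ₂ ζ s s' q q' : ℝ} (hs : 0 < s) (hss : s ≤ s') (hq : 0 < q)
    (h : NegProdEq ψ₁ ψ₂ ζ s q) (h' : NegProdEq ψ₁ ψ₂ ζ s' q') : q' ≤ q := by
  by_contra! hlt
  obtain ⟨-, -, hE⟩ := h
  obtain ⟨ha', hb', hE'⟩ := h'
  have hG : q + ζ ^ 2 * q / (1 + ζ ^ 2 * q) < q' + ζ ^ 2 * q' / (1 + ζ ^ 2 * q') := by
    refine add_lt_add_of_lt_of_le hlt ?_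
    have hq' := hq.trans hlt
    rw [div_le_div_iff₀ (by positivity) (by positivity)]
    nlinarith [mul_le_mul_of_nonneg_left hlt.le (sq_nonneg ζ)]
  -- If `q` grew, both positive factors `ψᵢ - G(q)` would shrink, while `s² q` would not.
  have h1 : s' ^ 2 * q' < s ^ 2 * q := by
    rw [hE, hE']
    apply mul_lt_mul'' <;> linarith
  have h2 : s ^ 2 * q ≤ s' ^ 2 * q' := by gcongr
  linarith

theorem proposition2 (μ₁ μs F₁ Fs τ : ℝ) (hμ₁ : 0 < μ₁) (hμs : 0 < μs) :
    -- the map is well defined: the pair of functions exists and is unique on the upper half plane,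
    -- the denominator in the formula does not vanish and the formula gives a real number
    (∀ ψ₁ ψ₂ : ℝ, 0 < ψ₁ → 0 < ψ₂ →
      (∃ ν : (ℂ → ℂ) × (ℂ → ℂ), IsNuPair ψ₁ ψ₂ (μ₁ / μs) ν ∧
        ∀ ν' : (ℂ → ℂ) × (ℂ → ℂ), IsNuPair ψ₁ ψ₂ (μ₁ / μs) ν' →
          EqOn ν'.1 ν.1 upperHalf ∧ EqOn ν'.2 ν.2 upperHalf) ∧
      ∀ lam : ℝ, 0 < lam →
        1 - chi μ₁ μs ψ₁ ψ₂ lam * ((μ₁ / μs : ℝ) : ℂ) ^ 2 ≠ 0 ∧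
        (limitPPV μ₁ μs F₁ Fs τ ψ₁ ψ₂ lam : ℂ) = limitPPVComplex μ₁ μs F₁ Fs τ ψ₁ ψ₂ lam) ∧
    -- it is non-decreasing in the regularization parameter
    (∀ ψ₁ ψ₂ : ℝ, 0 < ψ₁ → 0 < ψ₂ →
      MonotoneOn (fun lam : ℝ => limitPPV μ₁ μs F₁ Fs τ ψ₁ ψ₂ lam) (Ioi 0)) ∧
    -- for `ψ₁ = ψ₂` it has a finite limit as the regularization parameter decreases to zero
    (∀ ψ₁ ψ₂ : ℝ, 0 < ψ₁ → 0 < ψ₂ → ψ₁ = ψ₂ →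
      ∃ L : ℝ, Tendsto (fun lam : ℝ => limitPPV μ₁ μs F₁ Fs τ ψ₁ ψ₂ lam) (𝓝[>] 0) (𝓝 L)) := by
  have key : ∀ ψ₁ ψ₂ : ℝ, 0 < ψ₁ → 0 < ψ₂ → ∀ lam : ℝ, 0 < lam → ∃ q : ℝ, 0 < q ∧
      NegProdEq ψ₁ ψ₂ (μ₁ / μs) (√(ψ₁ * ψ₂ * lam) / μs) q ∧
      chi μ₁ μs ψ₁ ψ₂ lam = ((-q : ℝ) : ℂ) ∧ limitPPVComplex μ₁ μs F₁ Fs τ ψ₁ ψ₂ lam =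
        ((F₁ ^ 2 / (1 + q * (μ₁ / μs) ^ 2) + Fs ^ 2 + τ ^ 2 : ℝ) : ℂ) := by
    intro ψ₁ ψ₂ h₁ h₂ lam hlam
    obtain ⟨q, hq, hE, hchi⟩ := exists_negProdEq h₁ h₂ (μ₁ / μs)
      (s := √(ψ₁ * ψ₂ * lam) / μs) (by positivity)
    have hchi' : chi μ₁ μs ψ₁ ψ₂ lam = ((-q : ℝ) : ℂ) := hchi
    refine ⟨q, hq, hE, hchi', ?_⟩
    rw [limitPPVComplex, hchi']
    push_cast
    rw [neg_mul, sub_neg_eq_add]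
  have hval : ∀ ψ₁ ψ₂ lam q : ℝ, limitPPVComplex μ₁ μs F₁ Fs τ ψ₁ ψ₂ lam =
      ((F₁ ^ 2 / (1 + q * (μ₁ / μs) ^ 2) + Fs ^ 2 + τ ^ 2 : ℝ) : ℂ) →
      limitPPV μ₁ μs F₁ Fs τ ψ₁ ψ₂ lam = F₁ ^ 2 / (1 + q * (μ₁ / μs) ^ 2) + Fs ^ 2 + τ ^ 2 := by
    intro ψ₁ ψ₂ lam q h
    rw [limitPPV, h, Complex.ofReal_re]
  have hmono : ∀ ψ₁ ψ₂ : ℝ, 0 < ψ₁ → 0 < ψ₂ →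
      MonotoneOn (fun lam : ℝ => limitPPV μ₁ μs F₁ Fs τ ψ₁ ψ₂ lam) (Ioi 0) := by
    intro ψ₁ ψ₂ h₁ h₂ lam hlam lam' hlam' hle
    have hlam : 0 < lam := hlam
    obtain ⟨q, hq, hE, -, hF⟩ := key ψ₁ ψ₂ h₁ h₂ lam hlam
    obtain ⟨q', hq', hE', -, hF'⟩ := key ψ₁ ψ₂ h₁ h₂ lam' hlam'
    have hqq : q' ≤ q := hE.le_of_le (by positivity) (by gcongr) hq hE'
    simp only [hval _ _ _ _ hF, hval _ _ _ _ hF']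
    gcongr
  refine ⟨fun ψ₁ ψ₂ h₁ h₂ => ⟨⟨nuPair ψ₁ ψ₂ (μ₁ / μs), isNuPair_nuPair h₁ h₂ _,
    fun ν' hν' => (isNuPair_nuPair h₁ h₂ _).eqOn hν'⟩, fun lam hlam => ?_⟩, hmono,
    fun ψ₁ ψ₂ h₁ h₂ _ => ⟨_, (hmono ψ₁ ψ₂ h₁ h₂).tendsto_nhdsGT ?_⟩⟩
  · obtain ⟨q, hq, -, hchi, hF⟩ := key ψ₁ ψ₂ h₁ h₂ lam hlam
    refine ⟨?_, by rw [hval _ _ _ _ hF, hF]⟩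
    rw [hchi]
    have h : (1 + q * (μ₁ / μs) ^ 2 : ℝ) ≠ 0 := by positivity
    convert Complex.ofReal_ne_zero.2 h using 1
    push_cast
    ring
  -- A monotone function tends from the right to its infimum once it is bounded below, here by `0`.
  · refine ⟨0, ?_⟩
    rintro _ ⟨lam, hlam, rfl⟩
    obtain ⟨q, hq, -, -, hF⟩ := key ψ₁ ψ₂ h₁ h₂ lam hlam
    simp only [hval _ _ _ _ hF]
    positivity
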